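/- Let $\Lambda=\mathbb C[\mathbf p_1,\mathbf p_2,\dots]$ be the algebra of symmetric functions. For sequences $x=(x_1,x_2,\dots)$, $y=(y_1,y_2,\dots)$ of complex numbers with finitely many nonzero terms, let $f\mapsto f(x;y)$ be the algebra homomorphism $\Lambda\to\mathbb C$ with $\mathbf p_k(x;y)=\sum_i x_i^k+(-1)^{k-1}\sum_i y_i^k$ for $k\ge 1$. Put $H(u)=\exp\bigl(\sum_{k\ge1}\mathbf p_k u^{-k}/k\bigr)\in\Lambda[[u^{-1}]]$. Let $a=(a_i)_{i\in\mathbb Z}$ be an arbitrary sequence of complex numbers, let $(\tau^r a)_i=a_{i+r}$ for $r\in\mathbb Z$, and let $\widehat a_i=-a_{1-i}$. Define $h_{k;a}\in\Lambda$ for $k\ge1$ by the identity of formal series in $u^{-1}$ $$1+\sum_{k\ge1}\frac{h_{k;a}}{(u-a_1)\cdots(u-a_k)}=H(u),$$ and set $h_{0;a}=1$ and $h_{k;a}=0$ for $k<0$. For a Young diagram $\mu$ with rows $\mu_1\ge\mu_2\ge\dots$ and columns $\mu'_1\ge\mu'_2\ge\dots$, the multiparameter Schur function is $$s_{\mu;a}=\det\bigl[h_{\mu_i-i+j;\,\tau^{1-j}a}\bigr]_{i,j=1}^{N},$$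 where $N$ is any number at least the number of nonzero rows of $\mu$ (the determinant does not depend on $N$). Let $d$ be the number of diagonal squares of $\mu$, let $p_i=\mu_i-i$ and $q_i=\mu'_i-i$ for $1\le i\le d$, and put $$x(\mu)_i=a_{p_i+1},\quad y(\mu)_i=\widehat a_{q_i+1}\quad(1\le i\le d),\qquad x(\mu)_i=y(\mu)_i=0\quad(i>d).$$ Theorem 5.2. For every Young diagram $\mu$ and every sequence $a$ as above, $$s_{\mu;a}(x(\mu);y(\mu))=\prod_{(i,j)\in\mu}\bigl(a_{\mu_i-i+1}-a_{j-\mu'_j}\bigr).$$ In particular, if $a_i=i-\tfrac12$ for all $i\in\mathbb Z$, then $s_{\mu;a}(x(\mu);y(\mu))=\prod_{(i,j)\in\mu}h(i,j)$, where the hook length $h(i,j)$ is the number of squares of $\mu$ that are $(i,j)$ itself, or lie in row $i$ to the right of $(i,j)$, or in column $j$ below $(i,j)$. -/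

import Mathlib

namespace MultiSchur

/-- The algebra `Λ = ℂ[p₁, p₂, …]` of symmetric functions; the generator `X k` is the
power sum `p_k`, for `k = 1, 2, …`. -/
abbrev Sym : Type := MvPolynomial ℕ+ ℂ

/-- The super power sum `p_k(x;y) = ∑ x_i ^ k + (-1)^(k-1) ∑ y_i ^ k` at two sequences with
finitely many nonzero terms. -/
noncomputable def superPowerSum (x y : ℕ →₀ ℂ) (k : ℕ+) : ℂ :=
  (x.sum fun _ v => v ^ (k : ℕ)) + (-1) ^ ((k : ℕ) - 1) * (y.sum fun _ v => v ^ (k : ℕ))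

/-- The value `f(x;y)` of `f ∈ Λ` in the super realization: the algebra homomorphism sending
each generator `p_k` to the super power sum `p_k(x;y)`. -/
noncomputable def superEval (x y : ℕ →₀ ℂ) : Sym →ₐ[ℂ] ℂ :=
  MvPolynomial.aeval (superPowerSum x y)

/-- The series `∑_{k ≥ 1} p_k t^k / k` over `Λ`. -/
noncomputable def powerSumSeries : PowerSeries Sym :=
  PowerSeries.mk fun n =>
    if hn : 0 < n then MvPolynomial.C ((n : ℂ)⁻¹) * MvPolynomial.X (⟨n, hn⟩ : ℕ+) else 0

theorem hasSubst_powerSumSeries : PowerSeries.HasSubst powerSumSeries := by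
  apply PowerSeries.HasSubst.of_constantCoeff_zero'
  rw [← PowerSeries.coeff_zero_eq_constantCoeff_apply]
  simp [powerSumSeries]

/-- The generating series `H = 1 + ∑_{k ≥ 1} h_k t^k = exp (∑_{k ≥ 1} p_k t^k / k)` of the
complete homogeneous symmetric functions, with `t = 1/u`. -/
noncomputable def completeSeries : PowerSeries Sym :=
  (PowerSeries.exp Sym).subst powerSumSeries

/-- The inhomogeneous replacement of the power `1/u^k`: the expansion of
`1 / ((u - a₁) ⋯ (u - a_k))` in powers of `t = 1/u`.  Note `1/(u - c) = t / (1 - c t)`. -/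
noncomputable def shiftedPower (a : ℤ → ℂ) (k : ℕ) : PowerSeries ℂ :=
  ∏ i ∈ Finset.range k,
    (PowerSeries.X * (1 - PowerSeries.C (a ((i : ℤ) + 1)) * PowerSeries.X)⁻¹)

/-- The functions `h_{k;a}`, `k ≥ 0`, determined by
`1 + ∑_{k ≥ 1} h_{k;a} / ((u - a₁) ⋯ (u - a_k)) = H(u)`.
The system is unitriangular and is solved here recursively; `coeff_completeSeries` and
`multiH_unique` below say that this is the unique solution. -/
noncomputable def multiH (a : ℤ → ℂ) : ℕ → Sym
  | n => PowerSeries.coeff n completeSeries -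
      ∑ k : Fin n, MvPolynomial.C (PowerSeries.coeff n (shiftedPower a k)) * multiH a k
termination_by n => n
decreasing_by exact k.isLt

/-- The expansion of `1 / ((u - a₁) ⋯ (u - a_k))` starts with `1 / u^k`, so that at each order
only finitely many terms of the defining series of `multiH` contribute. -/
theorem coeff_shiftedPower (a : ℤ → ℂ) (k : ℕ) :
    (∀ n < k, PowerSeries.coeff n (shiftedPower a k) = 0) ∧
      PowerSeries.coeff k (shiftedPower a k) = 1 := by
  have h : shiftedPower a k = PowerSeries.X ^ k * ∏ i ∈ Finset.range k,
      (1 - PowerSeries.C (a ((i : ℤ) + 1)) * PowerSeries.X)⁻¹ := by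
    simp [shiftedPower, Finset.prod_mul_distrib]
  constructor
  · intro n hn
    rw [h, PowerSeries.coeff_X_pow_mul', if_neg (by omega)]
  · rw [h, PowerSeries.coeff_X_pow_mul']
    simp [map_prod]

/-- The defining identity of `h_{k;a}`, order by order in `1/u`. -/
theorem coeff_completeSeries (a : ℤ → ℂ) (n : ℕ) :
    PowerSeries.coeff n completeSeries = ∑ k ∈ Finset.range (n + 1),
      MvPolynomial.C (PowerSeries.coeff n (shiftedPower a k)) * multiH a k := by
  rw [Finset.sum_range_succ, (coeff_shiftedPower a n).2, multiH, Finset.sum_range]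
  simp

theorem multiH_unique (a : ℤ → ℂ) (g : ℕ → Sym)
    (hg : ∀ n, PowerSeries.coeff n completeSeries = ∑ k ∈ Finset.range (n + 1),
      MvPolynomial.C (PowerSeries.coeff n (shiftedPower a k)) * g k) : g = multiH a := by
  funext n
  induction n using Nat.strong_induction_on with
  | _ n ih =>
    have h1 := hg n
    rw [coeff_completeSeries a, Finset.sum_range_succ, Finset.sum_range_succ,
      Finset.sum_congr rfl (fun k hk => by rw [← ih k (Finset.mem_range.1 hk)]),
      (coeff_shiftedPower a n).2] at h1
    simpa using h1.symm

theorem multiH_zero (a : ℤ → ℂ) : multiH a 0 = 1 := by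
  have h0 : PowerSeries.constantCoeff powerSumSeries = 0 := by
    rw [← PowerSeries.coeff_zero_eq_constantCoeff_apply]
    simp [powerSumSeries]
  have h2 : PowerSeries.coeff 0 completeSeries = 1 := by
    have h3 := PowerSeries.constantCoeff_subst_eq_zero h0 (PowerSeries.exp Sym - 1) (by simp)
    rw [← PowerSeries.coe_substAlgHom hasSubst_powerSumSeries, map_sub, map_one,
      PowerSeries.coe_substAlgHom hasSubst_powerSumSeries, map_sub, sub_eq_zero] at h3
    rw [PowerSeries.coeff_zero_eq_constantCoeff_apply]
    refine Eq.trans ?_ (h3.trans ?_)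
    · rfl
    · exact map_one _
  rw [multiH]
  simp [h2]

/-- `h_{k;a}` for all integers `k`, being zero for negative `k`. -/
noncomputable def multiHInt (a : ℤ → ℂ) (k : ℤ) : Sym :=
  if 0 ≤ k then multiH a k.toNat else 0

/-- `(τ^r a)_i = a_{i + r}`. -/
def shift (r : ℤ) (a : ℤ → ℂ) : ℤ → ℂ := fun i => a (i + r)

/-- The Jacobi–Trudi determinant `det [h_{μ_i - i + j; τ^{1-j} a}]` of order `N`, where
`i, j = 1, …, N`.  Indices are shifted to start from `0`, as are the rows of a
`YoungDiagram`. -/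
noncomputable def jacobiTrudi (a : ℤ → ℂ) (μ : YoungDiagram) (N : ℕ) : Sym :=
  Matrix.det (Matrix.of fun i j : Fin N =>
    multiHInt (shift (-(j : ℤ)) a) ((μ.rowLen i : ℤ) - (i : ℤ) + (j : ℤ)))

/-- The multiparameter Schur function `s_{μ;a}`: the Jacobi–Trudi determinant of order equal to
the number `ℓ(μ)` of nonzero rows (any larger order gives the same, see `jacobiTrudi_eq`). -/
noncomputable def multiSchur (a : ℤ → ℂ) (μ : YoungDiagram) : Sym :=
  jacobiTrudi a μ (μ.colLen 0)

theorem jacobiTrudi_eq (a : ℤ → ℂ) (μ : YoungDiagram) {N : ℕ} (hN : μ.colLen 0 ≤ N) :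
    jacobiTrudi a μ N = multiSchur a μ := by
  induction N, hN using Nat.le_induction with
  | base => rfl
  | succ N hN ih =>
    rw [← ih]
    have hr : μ.rowLen N = 0 := by
      by_contra h
      have h1 : (N, 0) ∈ μ := YoungDiagram.mem_iff_lt_rowLen.2 (Nat.pos_of_ne_zero h)
      have h2 := YoungDiagram.mem_iff_lt_colLen.1 h1
      omega
    unfold jacobiTrudi
    rw [Matrix.det_succ_row _ (Fin.last N), Fin.sum_univ_castSucc]
    have hz : ∀ j : Fin N, multiHInt (shift (-(j : ℤ)) a) (-(N : ℤ) + (j : ℤ)) = 0 := by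
      intro j
      have := j.isLt
      rw [multiHInt, if_neg (by omega)]
    have h1 : multiHInt (shift (-(N : ℤ)) a) 0 = 1 := by simp [multiHInt, multiH_zero]
    simp only [Matrix.of_apply, Fin.val_last, hr, Fin.val_castSucc, Nat.cast_zero, zero_sub, hz,
      neg_add_cancel, h1, mul_zero, zero_mul, Finset.sum_const_zero, zero_add, mul_one]
    rw [Even.neg_one_pow ⟨N, rfl⟩, one_mul]
    congr 1
    ext i j
    simp [Matrix.submatrix]

/-- The dual sequence `â_i = -a_{1-i}`. -/
def dualSeq (a : ℤ → ℂ) : ℤ → ℂ := fun i => -a (-i + 1)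

/-- The number `d(μ)` of diagonal squares. -/
def depth (μ : YoungDiagram) : ℕ := (μ.cells.filter fun c => c.1 = c.2).card

/-- `x(μ)_i = a_{p_i + 1}` for `1 ≤ i ≤ d(μ)` and `0` for `i > d(μ)`, where `p_i = μ_i - i`;
the index `i` is shifted to start from `0`, so that `p + 1` becomes `μ.rowLen i - i`. -/
noncomputable def pointX (a : ℤ → ℂ) (μ : YoungDiagram) : ℕ →₀ ℂ :=
  Finsupp.onFinset (Finset.range (depth μ))
    (fun i => if i < depth μ then a ((μ.rowLen i : ℤ) - (i : ℤ)) else 0)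
    (by
      intro i hi
      by_contra h
      exact hi (if_neg (by simpa using h)))

/-- `y(μ)_i = â_{q_i + 1}` for `1 ≤ i ≤ d(μ)` and `0` for `i > d(μ)`, where `q_i = μ'_i - i`;
the index `i` is shifted to start from `0`. -/
noncomputable def pointY (a : ℤ → ℂ) (μ : YoungDiagram) : ℕ →₀ ℂ :=
  Finsupp.onFinset (Finset.range (depth μ))
    (fun i => if i < depth μ then dualSeq a ((μ.colLen i : ℤ) - (i : ℤ)) else 0)
    (by
      intro i hi
      by_contra h
      exact hi (if_neg (by simpa using h)))

/-- The hook length of the square `c`: the number of squares of `μ` that are `c` itself, or lie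
in its row to the right of it, or in its column below it. -/
def hookLength (μ : YoungDiagram) (c : ℕ × ℕ) : ℕ :=
  (μ.cells.filter fun b => (b.1 = c.1 ∧ c.2 ≤ b.2) ∨ (b.2 = c.2 ∧ c.1 ≤ b.1)).card

end MultiSchur

/-! Write `t = 1/u`, `α_r = a_{r-N+1}` with `N = ℓ(μ)`, and let `l_0 > … > l_{N-1}` be the beta
numbers of `μ`. At the given point `H` becomes `∏_{r<N} (1 - α_r t) / ∏_{k<N} (1 - α_{l_k} t)`
(`map_completeSeries_point`): the beta numbers past the diagonal and the gap numbers of the first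
`d` columns together fill `{0, …, N-1}`, so the remaining factors cancel.

Every Jacobi–Trudi entry is then a coefficient of one rational series
(`superEval_jacobiTrudi_entry`). Row `i` is a fixed linear functional, applied to the Newton
polynomials of degree `j` with nodes `a_0, a_{-1}, …`. Changing the nodes is a unitriangular column
operation, so the poles `α_{l_0}, α_{l_1}, …` may serve as nodes instead. The matrix becomes
triangular, and its `i`-th diagonal entry is `∏ (α_{l_i} - α_r)` over the `r < l_i` that are not
beta numbers (`det_coeff_eq_prod`). These `r` are the gap numbers of the first `μ_i` columns
(`range_sdiff_image_betaNumber`), one factor for each square of row `i`. -/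

namespace MultiSchur

/-! ### Coefficients of products of linear factors -/

open PowerSeries in
/-- The linear factor `1 - c t`. -/
noncomputable def linFactor (c : ℂ) : PowerSeries ℂ := 1 - C c * X

@[simp]
theorem constantCoeff_linFactor (c : ℂ) : PowerSeries.constantCoeff (linFactor c) = 1 := by
  simp [linFactor]

theorem linFactor_mul_inv (c : ℂ) : linFactor c * (linFactor c)⁻¹ = 1 :=
  PowerSeries.mul_inv_cancel _ (by simp)

theorem coeff_succ_linFactor_mul (c : ℂ) (f : PowerSeries ℂ) (n : ℕ) :
    PowerSeries.coeff (n + 1) (linFactor c * f) =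
      PowerSeries.coeff (n + 1) f - c * PowerSeries.coeff n f := by
  simp [linFactor, sub_mul, mul_assoc, PowerSeries.coeff_succ_X_mul]

theorem coeff_prod_linFactor_eq_zero {ι : Type*} (s : Finset ι) (f : ι → ℂ) {n : ℕ}
    (h : s.card < n) : PowerSeries.coeff n (∏ r ∈ s, linFactor (f r)) = 0 := by
  classical
  induction s using Finset.induction_on generalizing n with
  | empty => simp at h; simp [PowerSeries.coeff_one, h.ne']
  | insert r s hr ih =>
    rw [Finset.card_insert_of_notMem hr] at h
    obtain ⟨n, rfl⟩ : ∃ m, n = m + 1 := ⟨n - 1, by omega⟩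
    rw [Finset.prod_insert hr, coeff_succ_linFactor_mul, ih (by omega), ih (by omega)]
    simp

/-- The coefficient of `t^m` in `P(1/t) t^m / (1 - c t)`, where `m = deg P`, is `P(c)`. -/
theorem coeff_prod_linFactor_mul_inv {ι : Type*} (s : Finset ι) (f : ι → ℂ) (c : ℂ) :
    PowerSeries.coeff s.card ((∏ r ∈ s, linFactor (f r)) * (linFactor c)⁻¹) =
      ∏ r ∈ s, (c - f r) := by
  classical
  induction s using Finset.induction_on with
  | empty => simp
  | insert r s hr ih =>
    -- The product has degree at most `s.card`. Rewriting it as `(1 - c t)` times the quotient says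
    -- that the quotient's coefficient at `s.card + 1` is `c` times the one at `s.card`.
    have h : PowerSeries.coeff (s.card + 1) (∏ r ∈ s, linFactor (f r)) = 0 :=
      coeff_prod_linFactor_eq_zero s f (by omega)
    rw [← mul_one (∏ r ∈ s, linFactor (f r)), ← linFactor_mul_inv c, mul_left_comm,
      coeff_succ_linFactor_mul, ih] at h
    rw [Finset.card_insert_of_notMem hr, Finset.prod_insert hr, Finset.prod_insert hr, mul_assoc,
      coeff_succ_linFactor_mul, ih]
    linear_combination h

/-! ### Newton bases and triangularization of the determinant -/

/-- The linear functional `g ↦ ∑ m, g_m [t^(e+m)] B` on polynomials. -/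
noncomputable def coeffPairing (e : ℕ) (B : PowerSeries ℂ) : Polynomial ℂ →ₗ[ℂ] ℂ :=
  Polynomial.lsum fun m => PowerSeries.coeff (e + m) B • LinearMap.id

theorem coeffPairing_monomial (e : ℕ) (B : PowerSeries ℂ) (m : ℕ) (c : ℂ) :
    coeffPairing e B (Polynomial.monomial m c) = PowerSeries.coeff (e + m) B * c := by
  simp [coeffPairing, Polynomial.lsum_apply, Polynomial.sum_monomial_index]

/-- Multiplication by `X - z` on polynomials is adjoint to multiplication by `1 - z t` on series, at
the cost of raising the offset by one. This turns the `j`-dependent factors of a matrix entry into a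
Newton polynomial. -/
theorem coeffPairing_mul_X_sub_C (e : ℕ) (B : PowerSeries ℂ) (g : Polynomial ℂ) (z : ℂ) :
    coeffPairing e B (g * (Polynomial.X - Polynomial.C z)) =
      coeffPairing (e + 1) (linFactor z * B) g := by
  induction g using Polynomial.induction_on' with
  | add p q hp hq => rw [add_mul, map_add, map_add, hp, hq]
  | monomial m c =>
    rw [mul_sub, Polynomial.monomial_mul_X, Polynomial.monomial_mul_C, map_sub,
      coeffPairing_monomial, coeffPairing_monomial, coeffPairing_monomial,
      show e + 1 + m = e + m + 1 by omega, coeff_succ_linFactor_mul, ← add_assoc]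
    ring

theorem coeffPairing_prod (e : ℕ) (B : PowerSeries ℂ) (z : ℕ → ℂ) (j : ℕ) :
    coeffPairing e B (∏ r ∈ Finset.range j, (Polynomial.X - Polynomial.C (z r))) =
      PowerSeries.coeff (e + j) ((∏ r ∈ Finset.range j, linFactor (z r)) * B) := by
  induction j generalizing e B with
  | zero =>
    have := coeffPairing_monomial e B 0 1
    simpa using this
  | succ j ih =>
    rw [Finset.prod_range_succ, coeffPairing_mul_X_sub_C, ih, Finset.prod_range_succ, mul_assoc,
      add_right_comm, add_assoc]

/-- The determinant of functionals at the Newton polynomials with nodes `z` does not depend on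
the nodes. -/
theorem det_functional_newton {N : ℕ} (φ : Fin N → Polynomial ℂ →ₗ[ℂ] ℂ) (z : ℕ → ℂ) :
    Matrix.det (Matrix.of fun i j : Fin N =>
      φ i (∏ r ∈ Finset.range j, (Polynomial.X - Polynomial.C (z r)))) =
    Matrix.det (Matrix.of fun i j : Fin N => φ i (Polynomial.X ^ (j : ℕ))) := by
  set p : Fin N → Polynomial ℂ := fun j =>
    ∏ r ∈ Finset.range j, (Polynomial.X - Polynomial.C (z r)) with hp
  have hm : ∀ j, (p j).Monic := fun j =>
    Polynomial.monic_prod_of_monic _ _ fun r _ => Polynomial.monic_X_sub_C _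
  have hd : ∀ j, (p j).natDegree = j := fun j => by
    rw [hp, Polynomial.natDegree_prod_of_monic _ _ fun r _ => Polynomial.monic_X_sub_C _]
    simp
  rw [← mul_one (Matrix.det (Matrix.of fun i j : Fin N => φ i (Polynomial.X ^ (j : ℕ)))),
    ← Matrix.det_matrixOfPolynomials p hd hm, ← Matrix.det_mul]
  congr 1
  ext i j
  rw [Matrix.mul_apply]
  change φ i (p j) = ∑ k : Fin N, φ i (Polynomial.X ^ (k : ℕ)) * (p j).coeff k
  conv_lhs => rw [Polynomial.as_sum_range_C_mul_X_pow' (p j) (n := N) (by rw [hd]; exact j.isLt)]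
  rw [map_sum, Finset.sum_range]
  refine Finset.sum_congr rfl fun k _ => ?_
  rw [← Polynomial.smul_eq_C_mul, map_smul, smul_eq_mul, mul_comm]

/-- Evaluation of the determinant by passing to the Newton basis at the poles, which makes the
matrix triangular. -/
theorem det_coeff_eq_prod (N : ℕ) (l : ℕ → ℕ) (hl : ∀ i j, i < j → j < N → l j < l i)
    (α z : ℕ → ℂ) :
    Matrix.det (Matrix.of fun i j : Fin N => PowerSeries.coeff (l i + 1 + j)
      ((∏ r ∈ Finset.range j, linFactor (z r)) * (PowerSeries.X ^ N *
        ((∏ r ∈ Finset.range (l i), linFactor (α r)) *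
          (∏ k ∈ Finset.range N, linFactor (α (l k)))⁻¹)))) =
    ∏ i : Fin N, ∏ r ∈ Finset.range (l i) \ (Finset.Ico (i + 1 : ℕ) N).image l,
      (α (l i) - α r) := by
  have hinj : ∀ i, Set.InjOn l (Finset.Ico i N : Finset ℕ) := by
    intro i x hx y hy h
    simp only [Finset.coe_Ico, Set.mem_Ico] at hx hy
    by_contra hne
    rcases Nat.lt_or_gt_of_ne hne with h1 | h1
    · have := hl x y h1 hy.2; omega
    · have := hl y x h1 hx.2; omega
  set B : Fin N → PowerSeries ℂ := fun i => PowerSeries.X ^ N *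
        ((∏ r ∈ Finset.range (l i), linFactor (α r)) *
          (∏ k ∈ Finset.range N, linFactor (α (l k)))⁻¹) with hB
  change Matrix.det (Matrix.of fun i j : Fin N => PowerSeries.coeff (l i + 1 + j)
    ((∏ r ∈ Finset.range j, linFactor (z r)) * B i)) = _
  have h1 : ∀ z : ℕ → ℂ, (Matrix.of fun i j : Fin N => PowerSeries.coeff (l i + 1 + j)
      ((∏ r ∈ Finset.range j, linFactor (z r)) * B i)) = Matrix.of fun i j : Fin N =>
      coeffPairing (l i + 1) (B i)
        (∏ r ∈ Finset.range j, (Polynomial.X - Polynomial.C (z r))) := by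
    intro z
    ext i j
    simp only [Matrix.of_apply, coeffPairing_prod]
  have h2 : ∀ (i : Fin N) (j : ℕ), j ≤ N → (∏ r ∈ Finset.range j, linFactor (α (l r))) * B i =
      PowerSeries.X ^ N * ((∏ r ∈ Finset.range (l i), linFactor (α r)) *
        (∏ k ∈ Finset.Ico j N, linFactor (α (l k)))⁻¹) := by
    intro i j hj
    have hc : ∀ s : Finset ℕ, (∏ k ∈ s, linFactor (α (l k))) *
        (∏ k ∈ s, linFactor (α (l k)))⁻¹ = 1 := fun s =>
      PowerSeries.mul_inv_cancel _ (by simp [map_prod])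
    rw [hB]
    dsimp only
    rw [← Finset.prod_range_mul_prod_Ico _ hj, PowerSeries.mul_inv_rev]
    linear_combination (PowerSeries.X ^ N * ((∏ r ∈ Finset.range (l i), linFactor (α r)) *
        (∏ k ∈ Finset.Ico j N, linFactor (α (l k)))⁻¹)) * hc (Finset.range j)
  have h3 : ∀ (i : Fin N) (j : ℕ), i < j → ∏ r ∈ Finset.range (l i), linFactor (α r) =
      (∏ r ∈ Finset.range (l i) \ (Finset.Ico j N).image l, linFactor (α r)) *
        ∏ k ∈ Finset.Ico j N, linFactor (α (l k)) ∧
      (Finset.range (l i) \ (Finset.Ico j N).image l).card + (N - j) = l i := by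
    intro i j hij
    have hsub : (Finset.Ico j N).image l ⊆ Finset.range (l i) := by
      intro r hr
      obtain ⟨k, hk, rfl⟩ := Finset.mem_image.1 hr
      rw [Finset.mem_Ico] at hk
      exact Finset.mem_range.2 (hl _ _ (by omega) hk.2)
    constructor
    · rw [← Finset.prod_sdiff hsub, Finset.prod_image (f := fun r => linFactor (α r)) (hinj j)]
    · have := Finset.card_sdiff_add_card_eq_card hsub
      rwa [Finset.card_image_of_injOn (hinj j), Nat.card_Ico, Finset.card_range] at this
  -- Pass from the nodes `z` through monomials to the nodes `α (l r)`: column `j` then loses its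
  -- first `j` poles.
  rw [h1, det_functional_newton, ← det_functional_newton _ fun r => α (l r), ← h1,
    Matrix.det_of_isLowerTriangular]
  · refine Finset.prod_congr rfl fun i _ => ?_
    obtain ⟨h4, h5⟩ := h3 i (i + 1) (Nat.lt_succ_self _)
    have hi := i.isLt
    have hI : ∏ k ∈ Finset.Ico (i : ℕ) N, linFactor (α (l k)) =
        linFactor (α (l i)) * ∏ k ∈ Finset.Ico (i + 1 : ℕ) N, linFactor (α (l k)) :=
      Finset.prod_eq_prod_Ico_succ_bot hi _
    have hc : (∏ k ∈ Finset.Ico (i + 1 : ℕ) N, linFactor (α (l k))) *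
        (∏ k ∈ Finset.Ico (i + 1 : ℕ) N, linFactor (α (l k)))⁻¹ = 1 :=
      PowerSeries.mul_inv_cancel _ (by simp [map_prod])
    rw [Matrix.of_apply, h2 i i hi.le, h4, hI, PowerSeries.mul_inv_rev, mul_assoc,
      ← mul_assoc (∏ k ∈ Finset.Ico (i + 1 : ℕ) N, linFactor (α (l k))), hc, one_mul,
      ← coeff_prod_linFactor_mul_inv,
      show l i + 1 + (i : ℕ) = (Finset.range (l i) \ (Finset.Ico (i + 1 : ℕ) N).image l).card + N
        by omega, PowerSeries.coeff_X_pow_mul]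
  -- For `i < j` all remaining poles have index below `l i`, so the numerator cancels them. What is
  -- left has degree at most `l i - (N - j)`, and the coefficient taken is `1 + 2j - …` free of
  -- ambiguity only after removing `X ^ N`: its index `l i + 1 + j - N` is one too large.
  · intro i j hij
    have hij' : (i : ℕ) < j := hij
    obtain ⟨h4, h5⟩ := h3 i j hij'
    have hj := j.isLt
    rw [Matrix.of_apply, h2 i j hj.le, h4, mul_assoc,
      PowerSeries.mul_inv_cancel _ (by simp [map_prod]), mul_one,
      PowerSeries.coeff_X_pow_mul', if_pos (by omega), coeff_prod_linFactor_eq_zero]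
    omega

/-! ### Extracting coefficients in inhomogeneous powers -/

/-- The coefficients of the expansion of `S` in the inhomogeneous powers
`1 / ((u - b₁) ⋯ (u - b_k))`. -/
theorem coeff_mul_prod_linFactor_of_expansion (b : ℤ → ℂ) (S : PowerSeries ℂ) (h : ℕ → ℂ)
    (hS : ∀ n, PowerSeries.coeff n S = ∑ k ∈ Finset.range (n + 1),
      PowerSeries.coeff n (shiftedPower b k) * h k) (k : ℕ) :
    PowerSeries.coeff (k + 1) (S * ∏ s ∈ Finset.range k, linFactor (b ((s : ℤ) + 1))) =
      h (k + 1) := by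
  set P := ∏ s ∈ Finset.range k, linFactor (b ((s : ℤ) + 1)) with hP
  set T := ∑ m ∈ Finset.range (k + 2), h m • shiftedPower b m with hT
  have h0 : PowerSeries.coeff (k + 1) (S * P) = PowerSeries.coeff (k + 1) (T * P) := by
    rw [PowerSeries.coeff_mul, PowerSeries.coeff_mul]
    refine Finset.sum_congr rfl fun c hc => ?_
    congr 1
    have hc1 : c.1 ≤ k + 1 := by
      rw [Finset.HasAntidiagonal.mem_antidiagonal] at hc
      omega
    rw [hS, hT, map_sum]
    refine Finset.sum_subset_zero_on_sdiff (by simpa using by omega) ?_ ?_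
    · intro m hm
      simp only [Finset.mem_sdiff, Finset.mem_range] at hm
      simp [(coeff_shiftedPower b m).1 c.1 (by omega)]
    · intro m _
      simp [mul_comm]
  have hfac : ∀ m, shiftedPower b m = PowerSeries.X ^ m *
      ∏ s ∈ Finset.range m, (linFactor (b ((s : ℤ) + 1)))⁻¹ := by
    intro m
    simp [shiftedPower, Finset.prod_mul_distrib, linFactor]
  have hc : ∀ m, (∏ s ∈ Finset.range m, (linFactor (b ((s : ℤ) + 1)))⁻¹) *
      ∏ s ∈ Finset.range m, linFactor (b ((s : ℤ) + 1)) = 1 := by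
    intro m
    rw [← Finset.prod_mul_distrib]
    exact Finset.prod_eq_one fun s _ => by rw [mul_comm, linFactor_mul_inv]
  -- After multiplication by `P`, a term with `m ≤ k` is a polynomial of degree at most `k`; only `m
  -- = k + 1` reaches `t^(k+1)`, with leading coefficient `1`.
  rw [h0, hT, Finset.sum_mul, map_sum, Finset.sum_range_succ, Finset.sum_eq_zero, zero_add]
  · rw [smul_mul_assoc, PowerSeries.coeff_smul, hfac, Finset.prod_range_succ, mul_assoc,
      mul_right_comm _ _ P, hP, hc, one_mul]
    have := PowerSeries.coeff_X_pow_mul (linFactor (b ((k : ℤ) + 1)))⁻¹ (k + 1) 0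
    rw [zero_add] at this
    simp [this]
  · intro m hm
    rw [Finset.mem_range] at hm
    rw [smul_mul_assoc, PowerSeries.coeff_smul, hfac, hP,
      ← Finset.prod_range_mul_prod_Ico _ (show m ≤ k by omega), mul_assoc,
      ← mul_assoc (∏ s ∈ Finset.range m, (linFactor (b ((s : ℤ) + 1)))⁻¹), hc, one_mul,
      PowerSeries.coeff_X_pow_mul', if_pos (by omega), coeff_prod_linFactor_eq_zero, smul_zero]
    rw [Nat.card_Ico]; omega

/-! ### The series `H` in the super realization -/

section

open PowerSeries

/-- The logarithmic derivative of `1 - c t`, up to sign: `c / (1 - c t)`. -/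
noncomputable def geomSeries (c : ℂ) : PowerSeries ℂ := PowerSeries.mk fun n => c ^ (n + 1)

theorem geomSeries_mul_linFactor (c : ℂ) : geomSeries c * linFactor c = C c := by
  ext n
  rw [mul_comm]
  cases n with
  | zero => simp [linFactor, geomSeries]
  | succ n =>
    rw [coeff_succ_linFactor_mul]
    simp [geomSeries, pow_succ']

theorem derivative_prod_linFactor {ι : Type*} (s : Finset ι) (f : ι → ℂ) :
    PowerSeries.derivative ℂ (∏ i ∈ s, linFactor (f i)) =
      -(∑ i ∈ s, geomSeries (f i)) * ∏ i ∈ s, linFactor (f i) := by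
  classical
  induction s using Finset.induction_on with
  | empty => simp
  | insert r s hr ih =>
    have h : PowerSeries.derivative ℂ (linFactor (f r)) = -C (f r) := by simp [linFactor]
    rw [Finset.prod_insert hr, Finset.sum_insert hr, Derivation.leibniz, ih, smul_eq_mul,
      smul_eq_mul, h, ← geomSeries_mul_linFactor]
    ring

/-- Uniqueness for a first order linear differential equation. -/
theorem eq_of_derivative_eq_mul (Q V W : PowerSeries ℂ)
    (hV : PowerSeries.derivative ℂ V = Q * V) (hW : PowerSeries.derivative ℂ W = Q * W)
    (h0 : constantCoeff V = constantCoeff W) : V = W := by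
  ext n
  induction n using Nat.strong_induction_on with
  | _ n ih =>
    cases n with
    | zero => simpa using h0
    | succ n =>
      have h1 := congrArg (coeff n) hV
      have h2 := congrArg (coeff n) hW
      rw [coeff_derivative, coeff_mul] at h1 h2
      have h3 : coeff (n + 1) V * ((n : ℂ) + 1) = coeff (n + 1) W * ((n : ℂ) + 1) := by
        rw [h1, h2]
        refine Finset.sum_congr rfl fun c hc => ?_
        rw [Finset.HasAntidiagonal.mem_antidiagonal] at hc
        rw [ih c.2 (by omega)]
      exact mul_right_cancel₀ (Nat.cast_add_one_ne_zero n) h3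

/-- The value of `H(u)` in the super realization is `∏ (1 + y_i t) / ∏ (1 - x_i t)`. -/
theorem map_completeSeries_mul_prod (x y : ℕ →₀ ℂ) (d : ℕ) (hx : x.support ⊆ Finset.range d)
    (hy : y.support ⊆ Finset.range d) :
    completeSeries.map (superEval x y).toRingHom * ∏ i ∈ Finset.range d, linFactor (x i) =
      ∏ i ∈ Finset.range d, linFactor (-y i) := by
  set P : PowerSeries ℂ := powerSumSeries.map (superEval x y).toRingHom with hP
  have hcoeff : ∀ n, coeff (n + 1) P * ((n : ℂ) + 1) = (∑ i ∈ Finset.range d, x i ^ (n + 1)) +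
      (-1) ^ n * ∑ i ∈ Finset.range d, y i ^ (n + 1) := by
    intro n
    have hn : ((n : ℂ) + 1) ≠ 0 := Nat.cast_add_one_ne_zero n
    have h1 : x.sum (fun _ v => v ^ (n + 1)) = ∑ i ∈ Finset.range d, x i ^ (n + 1) :=
      Finsupp.sum_of_support_subset _ hx _ (by simp)
    have h2 : y.sum (fun _ v => v ^ (n + 1)) = ∑ i ∈ Finset.range d, y i ^ (n + 1) :=
      Finsupp.sum_of_support_subset _ hy _ (by simp)
    rw [← h1, ← h2]
    have hc : coeff (n + 1) P = ((n + 1 : ℕ) : ℂ)⁻¹ * superPowerSum x y n.succPNat := by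
      have h3 : coeff (n + 1) powerSumSeries =
          (MvPolynomial.C (((n + 1 : ℕ) : ℂ)⁻¹) * MvPolynomial.X n.succPNat : Sym) := by
        rw [powerSumSeries, coeff_mk, dif_pos n.succ_pos]
        rfl
      rw [hP, coeff_map, h3]
      change superEval x y _ = _
      rw [map_mul, superEval, MvPolynomial.aeval_X, MvPolynomial.aeval_C]
      rfl
    rw [hc, superPowerSum, Nat.succPNat_coe, Nat.succ_eq_add_one, Nat.add_sub_cancel]
    push_cast
    field_simp
  have hsub : HasSubst P := by
    apply HasSubst.of_constantCoeff_zero'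
    rw [← coeff_zero_eq_constantCoeff_apply]
    simp [hP, powerSumSeries]
  have hE : completeSeries.map (superEval x y).toRingHom = (PowerSeries.exp ℂ).subst P := by
    have := PowerSeries.map_subst hasSubst_powerSumSeries (h := (superEval x y).toRingHom)
      (PowerSeries.exp Sym)
    rw [PowerSeries.map_exp] at this
    exact this
  have hE0 : constantCoeff (completeSeries.map (superEval x y).toRingHom) = 1 := by
    have h1 := coeff_completeSeries (fun _ => 0) 0
    rw [← coeff_zero_eq_constantCoeff_apply, coeff_map, h1]
    simp [multiH_zero, shiftedPower]
  have hdP : PowerSeries.derivative ℂ P = (∑ i ∈ Finset.range d, geomSeries (x i)) -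
      ∑ i ∈ Finset.range d, geomSeries (-y i) := by
    ext n
    rw [coeff_derivative, hcoeff, map_sub, map_sum, map_sum, Finset.mul_sum, sub_eq_add_neg,
      ← Finset.sum_neg_distrib]
    simp only [geomSeries, coeff_mk]
    congr 1
    refine Finset.sum_congr rfl fun i _ => ?_
    rw [neg_pow (y i), pow_succ (-1 : ℂ)]
    ring
  -- Both sides have the same logarithmic derivative: the `x`-part of `P'` cancels against that of
  -- `∏ (1 - x_i t)`.
  refine eq_of_derivative_eq_mul (-∑ i ∈ Finset.range d, geomSeries (-y i)) _ _ ?_ ?_ ?_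
  · rw [Derivation.leibniz, derivative_prod_linFactor, hE, derivative_subst hsub,
      derivative_exp, hdP, smul_eq_mul, smul_eq_mul]
    ring
  · rw [derivative_prod_linFactor]
  · rw [map_mul, hE0, map_prod, map_prod]
    simp

end

/-! ### Beta numbers, gap numbers and the diagonal -/

/-- The beta numbers `μ_i - i + N` of a diagram with at most `N` rows, rows being indexed
from `0`. -/
def betaNumber (μ : YoungDiagram) (N i : ℕ) : ℕ := N - (i + 1) + μ.rowLen i

/-- The numbers complementary to the beta numbers. -/
def gapNumber (μ : YoungDiagram) (N j : ℕ) : ℕ := N + j - μ.colLen j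

theorem colLen_le {μ : YoungDiagram} {N : ℕ} (hN : μ.colLen 0 ≤ N) (j : ℕ) : μ.colLen j ≤ N :=
  (μ.colLen_anti 0 j (Nat.zero_le j)).trans hN

theorem lt_colLen_iff {μ : YoungDiagram} {i j : ℕ} : i < μ.colLen j ↔ j < μ.rowLen i :=
  YoungDiagram.mem_iff_lt_colLen.symm.trans YoungDiagram.mem_iff_lt_rowLen

theorem betaNumber_lt (μ : YoungDiagram) {N i j : ℕ} (hij : i < j) (hj : j < N) :
    betaNumber μ N j < betaNumber μ N i := by
  have := μ.rowLen_anti i j hij.le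
  unfold betaNumber
  omega

theorem gapNumber_lt {μ : YoungDiagram} {N i j : ℕ} (hN : μ.colLen 0 ≤ N) (hij : i < j) :
    gapNumber μ N i < gapNumber μ N j := by
  have := μ.colLen_anti i j hij.le
  have := colLen_le hN i
  unfold gapNumber
  omega

/-- The two numbers label vertical and horizontal steps of the boundary path: the beta number is the
larger one when `(i, j)` lies in `μ`, the smaller one otherwise. -/
theorem betaNumber_ne_gapNumber {μ : YoungDiagram} {N i j : ℕ} (hN : μ.colLen 0 ≤ N)
    (hi : i < N) : betaNumber μ N i ≠ gapNumber μ N j := by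
  have h := colLen_le hN j
  have h1 := @lt_colLen_iff μ i j
  unfold betaNumber gapNumber
  by_cases h2 : i < μ.colLen j
  · have := h1.1 h2
    omega
  · have := mt h1.2 h2
    omega

theorem injOn_betaNumber (μ : YoungDiagram) (N i : ℕ) :
    Set.InjOn (betaNumber μ N) (Finset.Ico i N : Finset ℕ) := by
  intro x hx y hy h
  simp only [Finset.coe_Ico, Set.mem_Ico] at hx hy
  by_contra hne
  rcases Nat.lt_or_gt_of_ne hne with h1 | h1
  · exact (betaNumber_lt μ h1 hy.2).ne' h
  · exact (betaNumber_lt μ h1 hx.2).ne h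

theorem injective_gapNumber {μ : YoungDiagram} {N : ℕ} (hN : μ.colLen 0 ≤ N) :
    Function.Injective (gapNumber μ N) :=
  StrictMono.injective fun _ _ h => gapNumber_lt hN h

theorem image_betaNumber_subset {μ : YoungDiagram} {N i k : ℕ} (h1 : μ.rowLen i ≤ k) :
    (Finset.Ico i N).image (betaNumber μ N) ⊆ Finset.range (N - i + k) := by
  intro r hr
  obtain ⟨m, hm, rfl⟩ := Finset.mem_image.1 hr
  rw [Finset.mem_Ico] at hm
  have := μ.rowLen_anti i m hm.1
  rw [Finset.mem_range, betaNumber]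
  omega

/-- The beta numbers of the rows below a corner region and the gap numbers of its columns fill
an initial interval. -/
theorem range_sdiff_image_betaNumber {μ : YoungDiagram} {N i k : ℕ} (hN : μ.colLen 0 ≤ N)
    (hi : i ≤ N) (h1 : μ.rowLen i ≤ k) (h2 : ∀ j < k, i ≤ μ.colLen j) :
    Finset.range (N - i + k) \ (Finset.Ico i N).image (betaNumber μ N) =
      (Finset.range k).image (gapNumber μ N) := by
  symm
  apply Finset.eq_of_subset_of_card_le
  · intro r hr
    obtain ⟨j, hj, rfl⟩ := Finset.mem_image.1 hr
    rw [Finset.mem_range] at hj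
    have h3 := h2 j hj
    have h4 := colLen_le hN j
    rw [Finset.mem_sdiff, Finset.mem_range, Finset.mem_image]
    refine ⟨by unfold gapNumber; omega, ?_⟩
    rintro ⟨m, hm, h⟩
    exact betaNumber_ne_gapNumber hN (Finset.mem_Ico.1 hm).2 h
  -- Both sides have `k` elements, so the inclusion suffices.
  · have := Finset.card_sdiff_add_card_eq_card (image_betaNumber_subset (N := N) h1)
    rw [Finset.card_image_of_injOn (injOn_betaNumber μ N i), Nat.card_Ico,
      Finset.card_range] at this
    rw [Finset.card_image_of_injective _ (injective_gapNumber hN), Finset.card_range]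
    omega

theorem mem_diag_iff (μ : YoungDiagram) (i : ℕ) : (i, i) ∈ μ ↔ i < depth μ := by
  classical
  have hex : ∃ n, (n, n) ∉ μ := by
    refine ⟨μ.rowLen 0, fun h => ?_⟩
    have := YoungDiagram.mem_iff_lt_rowLen.1 h
    have := μ.rowLen_anti 0 (μ.rowLen 0) (Nat.zero_le _)
    omega
  have hd : ∀ n, (n, n) ∈ μ ↔ n < Nat.find hex := by
    intro n
    constructor
    · intro h
      by_contra hn
      exact Nat.find_spec hex (μ.up_left_mem (not_lt.1 hn) (not_lt.1 hn) h)
    · intro h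
      simpa using Nat.find_min hex h
  have : depth μ = Nat.find hex := by
    have h : (μ.cells.filter fun c => c.1 = c.2) =
        (Finset.range (Nat.find hex)).image fun n => (n, n) := by
      ext ⟨x, y⟩
      simp only [Finset.mem_filter, YoungDiagram.mem_cells, Finset.mem_image, Finset.mem_range,
        Prod.mk.injEq]
      constructor
      · rintro ⟨h, rfl⟩
        exact ⟨x, (hd x).1 h, rfl, rfl⟩
      · rintro ⟨n, hn, rfl, rfl⟩
        exact ⟨(hd n).2 hn, rfl⟩
    rw [depth, h, Finset.card_image_of_injective _ fun x y h => (Prod.mk.inj h).1,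
      Finset.card_range]
  rw [this, hd]

theorem depth_le {μ : YoungDiagram} {N : ℕ} (hN : μ.colLen 0 ≤ N) : depth μ ≤ N := by
  rcases Nat.eq_zero_or_pos (depth μ) with h | h
  · omega
  · have h3 : (depth μ - 1, depth μ - 1) ∈ μ := (mem_diag_iff μ _).2 (by omega)
    have h4 := YoungDiagram.mem_iff_lt_colLen.1 h3
    have h5 := colLen_le hN (depth μ - 1)
    omega

/-- The corner of the largest square contained in `μ` satisfies the conditions of
`range_sdiff_image_betaNumber` with `i = k = depth μ`. -/
theorem prod_betaNumber_mul_prod_gapNumber {μ : YoungDiagram} {N : ℕ} (hN : μ.colLen 0 ≤ N)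
    {M : Type*} [CommMonoid M] (f : ℕ → M) :
    (∏ i ∈ Finset.Ico (depth μ) N, f (betaNumber μ N i)) *
      ∏ j ∈ Finset.range (depth μ), f (gapNumber μ N j) = ∏ r ∈ Finset.range N, f r := by
  have h1 : μ.rowLen (depth μ) ≤ depth μ := by
    by_contra h
    exact lt_irrefl _ ((mem_diag_iff μ _).1 (YoungDiagram.mem_iff_lt_rowLen.2 (not_le.1 h)))
  have h2 : ∀ j < depth μ, depth μ ≤ μ.colLen j := by
    intro j hj
    have h3 : (depth μ - 1, depth μ - 1) ∈ μ := (mem_diag_iff μ _).2 (by omega)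
    have h4 := YoungDiagram.mem_iff_lt_colLen.1 h3
    have h5 := μ.colLen_anti j (depth μ - 1) (by omega)
    omega
  have h3 := depth_le hN
  have h4 := image_betaNumber_subset (N := N) h1
  have h5 := range_sdiff_image_betaNumber hN h3 h1 h2
  rw [Nat.sub_add_cancel h3] at h4 h5
  rw [← Finset.prod_sdiff h4, h5, Finset.prod_image (injOn_betaNumber μ N _),
    Finset.prod_image (injective_gapNumber hN).injOn, mul_comm]

/-! ### Jacobi–Trudi entries at the point of `μ` -/

/-- At the point `(x(μ); y(μ))` the series `H(u)` becomes a ratio of products over the beta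
numbers of the empty diagram and of `μ`. -/
theorem map_completeSeries_point (a : ℤ → ℂ) {μ : YoungDiagram} {N : ℕ}
    (hN : μ.colLen 0 ≤ N) :
    completeSeries.map (superEval (pointX a μ) (pointY a μ)).toRingHom *
      ∏ i ∈ Finset.range N, linFactor (a (betaNumber μ N i - N + 1)) =
      ∏ r ∈ Finset.range N, linFactor (a ((r : ℤ) - N + 1)) := by
  have hd := depth_le hN
  rw [← Finset.prod_range_mul_prod_Ico _ hd, ← mul_assoc,
    ← prod_betaNumber_mul_prod_gapNumber hN fun r : ℕ => linFactor (a ((r : ℤ) - N + 1)),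
    mul_comm (∏ i ∈ Finset.Ico (depth μ) N, _)]
  congr 1
  have h := map_completeSeries_mul_prod (pointX a μ) (pointY a μ) (depth μ)
    Finsupp.support_onFinset_subset Finsupp.support_onFinset_subset
  convert h using 2
  · refine Finset.prod_congr rfl fun i hi => ?_
    rw [Finset.mem_range] at hi
    rw [pointX, Finsupp.onFinset_apply, if_pos hi]
    congr 2
    unfold betaNumber
    omega
  · rename_i j hj
    rw [Finset.mem_range] at hj
    have := colLen_le hN j
    rw [pointY, Finsupp.onFinset_apply, if_pos hj, dualSeq, neg_neg]
    congr 2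
    unfold gapNumber
    omega

/-- The shift `τ^{-j}` starts the auxiliary product at `a_{1-j}`. It continues the first `N - j`
factors of the numerator of `H` up to index `l_i`, and the other `j` numerator factors, taken
backwards, are the Newton nodes `a_0, …, a_{1-j}`. -/
theorem superEval_jacobiTrudi_entry (a : ℤ → ℂ) {μ : YoungDiagram} {N : ℕ}
    (hN : μ.colLen 0 ≤ N) (i j : Fin N) :
    superEval (pointX a μ) (pointY a μ) (multiHInt (shift (-(j : ℤ)) a)
      ((μ.rowLen i : ℤ) - (i : ℤ) + (j : ℤ))) =
    PowerSeries.coeff (betaNumber μ N i + 1 + j)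
      ((∏ r ∈ Finset.range j, linFactor (a (((N - 1 - r : ℕ) : ℤ) - N + 1))) *
        (PowerSeries.X ^ N *
        ((∏ r ∈ Finset.range (betaNumber μ N i), linFactor (a ((r : ℤ) - N + 1))) *
          (∏ k ∈ Finset.range N, linFactor (a (betaNumber μ N k - N + 1)))⁻¹))) := by
  have hi := i.isLt
  have hj := j.isLt
  have hH := map_completeSeries_point a hN
  set S := completeSeries.map (superEval (pointX a μ) (pointY a μ)).toRingHom with hS
  set D := ∏ k ∈ Finset.range N, linFactor (a (betaNumber μ N k - N + 1)) with hD
  have hD0 : PowerSeries.constantCoeff D = 1 := by simp [hD, map_prod]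
  have hDD : D * D⁻¹ = 1 := PowerSeries.mul_inv_cancel _ (by simp [hD0])
  rw [mul_left_comm, PowerSeries.coeff_X_pow_mul']
  have hb : betaNumber μ N i + 1 + j = N + μ.rowLen i + j - i := by unfold betaNumber; omega
  -- The cases are positive, zero and negative index of `h`. The factor `X ^ N` makes the
  -- coefficient vanish in the negative case.
  rcases lt_trichotomy ((i : ℕ)) (μ.rowLen i + j) with h | h | h
  · obtain ⟨k, hk⟩ : ∃ k, μ.rowLen i + j = i + (k + 1) := ⟨μ.rowLen i + j - i - 1, by omega⟩
    have hexp := coeff_mul_prod_linFactor_of_expansion (shift (-(j : ℤ)) a) S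
      (fun k => superEval (pointX a μ) (pointY a μ) (multiH (shift (-(j : ℤ)) a) k)) (by
        intro n
        rw [hS, PowerSeries.coeff_map, coeff_completeSeries (shift (-(j : ℤ)) a)]
        change superEval _ _ _ = _
        rw [map_sum]
        refine Finset.sum_congr rfl fun k _ => ?_
        rw [map_mul]
        congr 1
        exact MvPolynomial.aeval_C _ _) k
    rw [multiHInt, if_pos (by omega),
      show ((μ.rowLen i : ℤ) - (i : ℤ) + (j : ℤ)).toNat = k + 1 by omega, ← hexp,
      if_pos (by omega), show betaNumber μ N i + 1 + j - N = k + 1 by omega]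
    congr 1
    have e1 : ∏ r ∈ Finset.range N, linFactor (a ((r : ℤ) - N + 1)) =
        (∏ r ∈ Finset.range (N - j), linFactor (a ((r : ℤ) - N + 1))) *
        ∏ r ∈ Finset.range j, linFactor (a (((N - 1 - r : ℕ) : ℤ) - N + 1)) := by
      conv_lhs => rw [show N = (N - j) + j by omega, Finset.prod_range_add]
      congr 1
      · refine Finset.prod_congr rfl fun r _ => ?_
        congr 2
        omega
      · rw [← Finset.prod_range_reflect]
        refine Finset.prod_congr rfl fun r hr => ?_
        rw [Finset.mem_range] at hr
        congr 2
        omega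
    have e2 : ∏ r ∈ Finset.range (betaNumber μ N i), linFactor (a ((r : ℤ) - N + 1)) =
        (∏ r ∈ Finset.range (N - j), linFactor (a ((r : ℤ) - N + 1))) *
        ∏ s ∈ Finset.range k, linFactor (shift (-(j : ℤ)) a ((s : ℤ) + 1)) := by
      rw [show betaNumber μ N i = (N - j) + k by unfold betaNumber; omega, Finset.prod_range_add]
      congr 1
      refine Finset.prod_congr rfl fun r _ => ?_
      rw [shift]
      congr 2
      omega
    rw [e1] at hH
    rw [e2]
    have hS2 : S = (∏ r ∈ Finset.range (N - j), linFactor (a ((r : ℤ) - N + 1))) *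
        (∏ r ∈ Finset.range j, linFactor (a (((N - 1 - r : ℕ) : ℤ) - N + 1))) * D⁻¹ := by
      rw [← hH, mul_assoc, hDD, mul_one]
    rw [hS2]
    ring
  · rw [multiHInt, if_pos (by omega),
      show ((μ.rowLen i : ℤ) - (i : ℤ) + (j : ℤ)).toNat = 0 by omega, multiH_zero, map_one,
      if_pos (by omega), show betaNumber μ N i + 1 + j - N = 0 by omega,
      PowerSeries.coeff_zero_eq_constantCoeff_apply]
    simp [map_prod, PowerSeries.constantCoeff_inv, hD0]
  · rw [multiHInt, if_neg (by omega), map_zero, if_neg (by omega)]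

/-! ### Products over squares, and hook lengths -/

theorem prod_cells_eq_prod_rows {μ : YoungDiagram} {N : ℕ} (hN : μ.colLen 0 ≤ N) {M : Type*}
    [CommMonoid M] (f : ℕ × ℕ → M) :
    ∏ c ∈ μ.cells, f c = ∏ i ∈ Finset.range N, ∏ j ∈ Finset.range (μ.rowLen i), f (i, j) := by
  rw [← Finset.prod_fiberwise_of_maps_to (s := μ.cells) (t := Finset.range N) (g := Prod.fst)]
  · refine Finset.prod_congr rfl fun i _ => ?_
    have : (μ.cells.filter fun c => c.1 = i) = {i} ×ˢ Finset.range (μ.rowLen i) :=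
      YoungDiagram.row_eq_prod
    rw [this, Finset.prod_product, Finset.prod_singleton]
  · rintro ⟨i, j⟩ hc
    have := YoungDiagram.mem_iff_lt_colLen.1 ((YoungDiagram.mem_cells _).1 hc)
    exact Finset.mem_range.2 (this.trans_le (colLen_le hN j))

theorem superEval_multiSchur (a : ℤ → ℂ) (μ : YoungDiagram) :
    superEval (pointX a μ) (pointY a μ) (multiSchur a μ) =
      ∏ c ∈ μ.cells, (a ((μ.rowLen c.1 : ℤ) - ((c.1 : ℤ) + 1) + 1) -
        a (((c.2 : ℤ) + 1) - (μ.colLen c.2 : ℤ))) := by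
  obtain ⟨N, hN'⟩ : ∃ N, N = μ.colLen 0 := ⟨_, rfl⟩
  have hN : μ.colLen 0 ≤ N := hN'.ge
  rw [multiSchur, ← hN', jacobiTrudi, AlgHom.map_det, prod_cells_eq_prod_rows hN,
    Finset.prod_range]
  have hmat : (superEval (pointX a μ) (pointY a μ)).mapMatrix (Matrix.of fun i j : Fin N =>
      multiHInt (shift (-(j : ℤ)) a) ((μ.rowLen i : ℤ) - (i : ℤ) + (j : ℤ))) = _ :=
    Matrix.ext fun i j => superEval_jacobiTrudi_entry a hN i j
  rw [hmat]
  refine (det_coeff_eq_prod N (betaNumber μ N) (fun i j => betaNumber_lt μ)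
    (fun r => a ((r : ℤ) - N + 1)) fun r => a (((N - 1 - r : ℕ) : ℤ) - N + 1)).trans ?_
  refine Finset.prod_congr rfl fun i _ => ?_
  have hi := i.isLt
  -- For the rows below row `i` and `k = μ.rowLen i`, the interval has length `N - (i + 1) +
  -- μ.rowLen i`, which is the beta number of row `i`.
  have h := range_sdiff_image_betaNumber (k := μ.rowLen i) hN (Nat.succ_le_of_lt hi)
    (μ.rowLen_anti i (i + 1) (Nat.le_succ _)) fun j hj => lt_colLen_iff.2 hj
  rw [betaNumber, h, Finset.prod_image (injective_gapNumber hN).injOn]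
  refine Finset.prod_congr rfl fun j _ => ?_
  have := colLen_le hN j
  unfold gapNumber
  dsimp only
  congr 2
  · omega
  · omega

/-- The hook is the disjoint union of the arm with its corner and the leg. The additive form avoids
truncated subtraction. -/
theorem hookLength_add_eq {μ : YoungDiagram} {i j : ℕ} (h : (i, j) ∈ μ) :
    hookLength μ (i, j) + i + j + 1 = μ.rowLen i + μ.colLen j := by
  have h1 := YoungDiagram.mem_iff_lt_rowLen.1 h
  have h2 := YoungDiagram.mem_iff_lt_colLen.1 h
  have hset : (μ.cells.filter fun b => (b.1 = i ∧ j ≤ b.2) ∨ (b.2 = j ∧ i ≤ b.1)) =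
      {i} ×ˢ Finset.Ico j (μ.rowLen i) ∪ Finset.Ico (i + 1) (μ.colLen j) ×ˢ {j} := by
    ext ⟨x, y⟩
    simp only [Finset.mem_filter, YoungDiagram.mem_cells, Finset.mem_union, Finset.mem_product,
      Finset.mem_singleton, Finset.mem_Ico]
    constructor
    · rintro ⟨hm, ⟨rfl, hy⟩ | ⟨rfl, hx⟩⟩
      · exact Or.inl ⟨rfl, hy, YoungDiagram.mem_iff_lt_rowLen.1 hm⟩
      · rcases hx.eq_or_lt with rfl | hx
        · exact Or.inl ⟨rfl, le_rfl, h1⟩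
        · exact Or.inr ⟨⟨hx, YoungDiagram.mem_iff_lt_colLen.1 hm⟩, rfl⟩
    · rintro (⟨rfl, hy, hm⟩ | ⟨⟨hx, hm⟩, rfl⟩)
      · exact ⟨YoungDiagram.mem_iff_lt_rowLen.2 hm, Or.inl ⟨rfl, hy⟩⟩
      · exact ⟨YoungDiagram.mem_iff_lt_colLen.2 hm, Or.inr ⟨rfl, by omega⟩⟩
  have hdisj : Disjoint ({i} ×ˢ Finset.Ico j (μ.rowLen i))
      (Finset.Ico (i + 1) (μ.colLen j) ×ˢ {j}) := by
    rw [Finset.disjoint_left]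
    rintro ⟨x, y⟩ hx hy
    simp only [Finset.mem_product, Finset.mem_singleton, Finset.mem_Ico] at hx hy
    omega
  have hcard : hookLength μ (i, j) = (μ.rowLen i - j) + (μ.colLen j - (i + 1)) := by
    change (μ.cells.filter fun b => (b.1 = i ∧ j ≤ b.2) ∨ (b.2 = j ∧ i ≤ b.1)).card = _
    rw [hset, Finset.card_union_of_disjoint hdisj]
    simp
  omega

end MultiSchur

theorem theorem5p2 (μ : YoungDiagram) :
    (∀ a : ℤ → ℂ,
      MultiSchur.superEval (MultiSchur.pointX a μ) (MultiSchur.pointY a μ)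
          (MultiSchur.multiSchur a μ) =
        ∏ c ∈ μ.cells,
          (a ((μ.rowLen c.1 : ℤ) - ((c.1 : ℤ) + 1) + 1) -
            a (((c.2 : ℤ) + 1) - (μ.colLen c.2 : ℤ)))) ∧
    (∀ a : ℤ → ℂ, (∀ i : ℤ, a i = (i : ℂ) - 1 / 2) →
      MultiSchur.superEval (MultiSchur.pointX a μ) (MultiSchur.pointY a μ)
          (MultiSchur.multiSchur a μ) =
        ∏ c ∈ μ.cells, (MultiSchur.hookLength μ c : ℂ)) := by
  refine ⟨fun a => MultiSchur.superEval_multiSchur a μ, fun a ha => ?_⟩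
  rw [MultiSchur.superEval_multiSchur]
  refine Finset.prod_congr rfl fun c hc => ?_
  have h := congrArg (Nat.cast : ℕ → ℂ)
    (MultiSchur.hookLength_add_eq (μ := μ) (i := c.1) (j := c.2) ((YoungDiagram.mem_cells _).1 hc))
  push_cast at h
  rw [ha, ha]
  push_cast
  -- The halves cancel in the difference, leaving `μ_i + μ'_j - i - j - 1` with `i`, `j` counted
  -- from `0`.
  linear_combination -h
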